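/- Let $\mathcal A$ be a set of agents, $\mathcal I$ a set of institutions and $\mathcal X$ a finite set of contracts; each contract $x$ names one agent $\alpha(x)\in\mathcal A$ and one institution. For $X\subseteq\mathcal X$, let $X_a$ and $X_i$ denote the sets of contracts in $X$ that name agent $a$ and institution $i$, respectively. For each $i\in\mathcal I$, let $\mathcal F_i$ be the collection of feasible subsets of $\mathcal X_i$, where $(\mathcal X_i,\mathcal F_i)$ is a matroid with independent sets $\mathcal F_i$ and rank function $r_i$, and let $\succ_i$ be a (strict) linear order over $\mathcal X_i$, the priority ordering. A matching is a set $X\subseteq\mathcal X$ with $|X_a|\le 1$ for all $a\in\mathcal A$. A problem is a profile $R=(R_a)_{a\in\mathcal A}$ in which $R_a$ is a linear order over $\mathcal X_a\cup\{\emptyset\}$, with strict part $P_a$, where $\emptyset$ is the null contract (being unassigned). A contract $x\in\mathcal X_a$ is acceptable if $x\mathrel{R_a}\emptyset$. At a matching $X$, $X_a$ also denotes the contract of $a$ in $X$, or $\emptyset$ if there is none. A matching rule $\varphi$ assigns a matching $\varphi(R)$ to every problem $R$. *Greedy rule.* For $Y\subseteq\mathcal X_i$, go through the elements of $Y$ from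 the highest to the lowest priority under $\succ_i$, starting from the empty set, and add an element to the set chosen so far if and only if the resulting set is in $\mathcal F_i$. The final set is $G_i(Y)$. *Deferred acceptance (DA) based on $G=(G_i)_{i\in\mathcal I}$.* At step 1, each agent proposes their most preferred acceptable contract (if any). At each later step, each agent whose contract was rejected at the previous step proposes their next most preferred acceptable contract (if any). At each step, each institution $i$ considers the set $Y$ of the contracts it tentatively accepted at the previous step together with its new proposals, tentatively accepts $G_i(Y)$, and permanently rejects $Y\setminus G_i(Y)$. The algorithm stops at the first step without a rejection, and its outcome is the set of the contracts accepted at that step. **Statement.** A matching rule $\varphi$ satisfies conditions (i)–(iv) for the matching $X=\varphi(R)$ at every problem $R$, and condition (v), - (i) feasibility: $X_i\in\mathcal F_i$ for all $i\in\mathcal I$; - (ii) rank maximality: for all $i\in\mathcal I$ and $x\in\mathcal X_i\setminus X_i$ with $x\mathrel{P_{\alpha(x)}}X_{\alpha(x)}$, $r_i(X_i\cup\{x\})=r_i(X_i)$; - (iii) no justified envy under rank: for all $i\in\mathcal I$, $x\in X_i$ and $y\in\mathcal X_i\setminus X_i$ with $y\mathrel{P_{\alpha(y)}}X_{\alpha(y)}$,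 if $y\succ_i x$ then $r_i((X_i\setminus\{x\})\cup\{y\})<r_i(X_i)$; - (iv) individual rationality: $X_a\mathrel{R_a}\emptyset$ for all $a\in\mathcal A$; - (v) strategy-proofness: for every problem $R$, every agent $a$ and every linear order $R'_a$ over $\mathcal X_a\cup\{\emptyset\}$, $\varphi_a(R)\mathrel{R_a}\varphi_a(R'_a,R_{-a})$, where $\varphi_a(R)$ denotes the assignment of $a$ at $\varphi(R)$ and $R_{-a}$ the preferences of the other agents; if and only if $\varphi$ is the DA rule based on $G$. -/

import Mathlib

/-!
Matching with contracts. `A` is the set of agents, `I` the set of institutions and `X` the finite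
set of contracts; `agent x` and `inst x` are the agent and the institution of the contract `x`.
-/

namespace MatchingContracts

universe u v w

/-- A linear order on `α`, given by its weak relation; `weak x y` reads "`x` is at least as good
as `y`" (for a preference) or "`x` has at least the priority of `y`" (for a priority ordering). -/
structure LinPref (α : Type u) where
  weak : α → α → Prop
  total : ∀ x y, weak x y ∨ weak y x
  trans : ∀ x y z, weak x y → weak y z → weak x z
  antisymm : ∀ x y, weak x y → weak y x → x = y

/-- The strict part of a linear order. -/
def LinPref.strict {α : Type u} (r : LinPref α) (x y : α) : Prop :=
  r.weak x y ∧ x ≠ y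

theorem LinPref.strict_trans {α : Type u} (r : LinPref α) {x y z : α}
    (h₁ : r.strict x y) (h₂ : r.strict y z) : r.strict x z := by
  refine ⟨r.trans _ _ _ h₁.1 h₂.1, ?_⟩
  rintro rfl
  exact h₁.2 (r.antisymm _ _ h₁.1 h₂.1)

/-- A choice rule on `α`: it chooses a subset of every set of contracts. -/
structure ChoiceRule (α : Type u) where
  choose : Set α → Set α
  choose_subset : ∀ S, choose S ⊆ S

/-! ### The greedy choice rule of a matroid -/

section Greedy

variable {α : Type u}

/-- The set chosen after `s` steps of the greedy procedure on the set `S`. The element considered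
at step `s + 1` is the `(s + 1)`-st highest priority element of `S`, that is, the element of `S`
which has exactly `s` elements of `S` above it. -/
def greedyStage (M : Matroid α) (p : LinPref α) (S : Set α) : ℕ → Set α
  | 0 => ∅
  | s + 1 => greedyStage M p S s ∪
      {x | x ∈ S ∧ {y | y ∈ S ∧ p.strict y x}.encard = (s : ℕ∞) ∧
        M.Indep (insert x (greedyStage M p S s))}

theorem greedyStage_subset (M : Matroid α) (p : LinPref α) (S : Set α) (s : ℕ) :
    greedyStage M p S s ⊆ S := by
  induction s with
  | zero => exact Set.empty_subset _
  | succ s ih => exact Set.union_subset ih (fun _ hx => hx.1)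

/-- The greedy choice rule: the outcome of the greedy procedure after `|S|` steps. -/
noncomputable def greedyRule (M : Matroid α) (p : LinPref α) : ChoiceRule α where
  choose S := greedyStage M p S S.ncard
  choose_subset S := greedyStage_subset M p S _

end Greedy

section Model

variable {A : Type u} {I : Type v} {X : Type w}

/-- The contracts of agent `a`. -/
abbrev AgentContract (agent : X → A) (a : A) : Type w := {x : X // agent x = a}

/-- The contracts of institution `i`. -/
abbrev InstContract (inst : X → I) (i : I) : Type w := {x : X // inst x = i}

/-- The set of contracts in `Y` that include institution `i`. -/
def instPart (inst : X → I) (Y : Set X) (i : I) : Set (InstContract inst i) :=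
  {x | (x : X) ∈ Y}

/-- The set of contracts in `Y` that include agent `a`. -/
def agentPart (agent : X → A) (Y : Set X) (a : A) : Set (AgentContract agent a) :=
  {x | (x : X) ∈ Y}

/-- A matching problem: for every agent a linear order over the contracts of this agent and the
null contract `none`. -/
abbrev Profile (agent : X → A) : Type (max u w) :=
  ∀ a : A, LinPref (Option (AgentContract agent a))

/-- A matching: a set of contracts with at most one contract for each agent. -/
structure Matching (agent : X → A) where
  contracts : Set X
  card_le_one : ∀ a : A, (agentPart agent contracts a).encard ≤ 1

theorem card_le_one_iff (agent : X → A) (Y : Set X) :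
    (∀ a : A, (agentPart agent Y a).encard ≤ 1) ↔
      ∀ x ∈ Y, ∀ y ∈ Y, agent x = agent y → x = y := by
  constructor
  · intro h x hx y hy hxy
    have := Set.encard_le_one_iff.1 (h (agent y)) ⟨x, hxy⟩ ⟨y, rfl⟩ hx hy
    exact congrArg Subtype.val this
  · intro h a
    refine Set.encard_le_one_iff.2 ?_
    rintro ⟨x, rfl⟩ ⟨y, hya⟩ hx hy
    exact Subtype.ext (h x hx y hy hya.symm)

open Classical in
/-- The assignment of agent `a` at a matching: the contract of `a` in the matching, or the null
contract if there is none. -/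
noncomputable def Matching.assignment {agent : X → A} (μ : Matching agent) (a : A) :
    Option (AgentContract agent a) :=
  if h : (agentPart agent μ.contracts a).Nonempty then some h.some else none

/-- The agent of the contract `x` strictly prefers `x` to their assignment at `μ`. -/
def PrefersToAssignment {agent : X → A} (R : Profile agent) (μ : Matching agent) (x : X) : Prop :=
  (R (agent x)).strict (some ⟨x, rfl⟩) (μ.assignment (agent x))

/-- A matching rule associates a matching with each matching problem. -/
abbrev MatchingRule (agent : X → A) : Type (max u w) := Profile agent → Matching agent

/-! ### Axioms on matchings -/

/-- Individual rationality of a matching. -/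
def IndividuallyRational {agent : X → A} (R : Profile agent) (μ : Matching agent) : Prop :=
  ∀ a : A, (R a).weak (μ.assignment a) none

/-- Feasibility of a matching: the feasible sets of institution `i` are the independent sets
of `M i`. -/
def Feasible {agent : X → A} (inst : X → I) (M : ∀ i, Matroid (InstContract inst i))
    (μ : Matching agent) : Prop :=
  ∀ i, (M i).Indep (instPart inst μ.contracts i)

/-- Rank maximality of a matching. -/
def RankMaximal {agent : X → A} (inst : X → I) (M : ∀ i, Matroid (InstContract inst i))
    (R : Profile agent) (μ : Matching agent) : Prop :=
  ∀ i, ∀ x : InstContract inst i, x ∉ instPart inst μ.contracts i →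
    PrefersToAssignment R μ x →
      (M i).eRk (instPart inst μ.contracts i ∪ {x}) = (M i).eRk (instPart inst μ.contracts i)

/-- No justified envy under rank of a matching. -/
def NoJustifiedEnvyUnderRank {agent : X → A} (inst : X → I)
    (M : ∀ i, Matroid (InstContract inst i)) (prio : ∀ i, LinPref (InstContract inst i))
    (R : Profile agent) (μ : Matching agent) : Prop :=
  ∀ i, ∀ x ∈ instPart inst μ.contracts i, ∀ y : InstContract inst i,
    y ∉ instPart inst μ.contracts i → PrefersToAssignment R μ y → (prio i).strict y x →
      (M i).eRk ((instPart inst μ.contracts i \ {x}) ∪ {y}) <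
        (M i).eRk (instPart inst μ.contracts i)

open Classical in
/-- Strategy-proofness of a matching rule. -/
def StrategyProof {agent : X → A} (φ : MatchingRule agent) : Prop :=
  ∀ (R : Profile agent) (a : A) (Ra' : LinPref (Option (AgentContract agent a))),
    (R a).weak ((φ R).assignment a) ((φ (Function.update R a Ra')).assignment a)

/-! ### The deferred-acceptance rule -/

/-- The contract `x` is acceptable to its agent. -/
def Acceptable {agent : X → A} (R : Profile agent) (x : X) : Prop :=
  (R (agent x)).weak (some ⟨x, rfl⟩) none

/-- `x` is the most preferred acceptable contract of its agent. -/
def IsTop {agent : X → A} (R : Profile agent) (x : X) : Prop :=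
  Acceptable R x ∧ ∀ z, ∀ hz : agent z = agent x, Acceptable R z →
    (R (agent x)).weak (some ⟨x, rfl⟩) (some ⟨z, hz⟩)

/-- `x` is the next most preferred acceptable contract after `y` of their common agent. -/
def IsNext {agent : X → A} (R : Profile agent) (y x : X) : Prop :=
  ∃ h : agent y = agent x, Acceptable R x ∧
    (R (agent x)).strict (some ⟨y, h⟩) (some ⟨x, rfl⟩) ∧
    ∀ z, ∀ hz : agent z = agent x, Acceptable R z →
      (R (agent x)).strict (some ⟨y, h⟩) (some ⟨z, hz⟩) →
        (R (agent x)).weak (some ⟨x, rfl⟩) (some ⟨z, hz⟩)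

/-- The contracts accepted when each institution `i` applies its choice rule to its contracts
in `Y`. -/
def accepted {inst : X → I} (C : ∀ i, ChoiceRule (InstContract inst i)) (Y : Set X) : Set X :=
  {x | (⟨x, rfl⟩ : InstContract inst (inst x)) ∈ (C (inst x)).choose (instPart inst Y (inst x))}

theorem accepted_subset {inst : X → I} (C : ∀ i, ChoiceRule (InstContract inst i)) (Y : Set X) :
    accepted C Y ⊆ Y := fun _ hx => (C _).choose_subset _ hx

/-- `considered C R s` is the set of contracts considered by the institutions at step `s + 1` of
the deferred-acceptance algorithm: at the first step the most preferred acceptable contract of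
each agent; at a later step the tentatively accepted contracts of the previous step, together
with the next most preferred acceptable contract of each agent who was rejected in that step. -/
def considered {agent : X → A} {inst : X → I} (C : ∀ i, ChoiceRule (InstContract inst i))
    (R : Profile agent) : ℕ → Set X
  | 0 => {x | IsTop R x}
  | s + 1 => accepted C (considered C R s) ∪
      {x | ∃ y ∈ considered C R s \ accepted C (considered C R s), IsNext R y x}

/-- The contracts rejected at step `s + 1` of the deferred-acceptance algorithm. -/
def rejected {agent : X → A} {inst : X → I} (C : ∀ i, ChoiceRule (InstContract inst i))
    (R : Profile agent) (s : ℕ) : Set X :=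
  considered C R s \ accepted C (considered C R s)

theorem considered_unique {agent : X → A} {inst : X → I}
    (C : ∀ i, ChoiceRule (InstContract inst i)) (R : Profile agent) (s : ℕ) :
    ∀ x ∈ considered C R s, ∀ y ∈ considered C R s, agent x = agent y → x = y := by
  induction s with
  | zero =>
    rintro x ⟨hx, hx'⟩ y ⟨hy, hy'⟩ hxy
    have h₁ := hx' y hxy.symm hy
    have h₂ := hy' x hxy hx
    generalize_proofs at h₁ h₂
    have h₃ : ∀ a (ha : agent x = a) (hb : agent y = a),
        (R a).weak (some ⟨y, hb⟩) (some ⟨x, ha⟩) := by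
      rintro a ha rfl; exact h₂
    have := (R (agent x)).antisymm _ _ h₁ (h₃ _ rfl hxy.symm)
    simpa using this
  | succ s ih =>
    have key : ∀ x y z : X, IsNext R z x → IsNext R z y → x = y := by
      rintro x y z ⟨hx, hax, hsx, hmx⟩ ⟨hy, hay, hsy, hmy⟩
      have h₁ : ∀ a (hza : agent z = a) (hxa : agent x = a) (hya : agent y = a),
          (R a).weak (some ⟨x, hxa⟩) (some ⟨y, hya⟩) := by
        rintro a hza rfl hya
        refine hmx y hya hay ?_
        have : ∀ b (hzb : agent z = b) (hyb : agent y = b),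
            (R b).strict (some ⟨z, hzb⟩) (some ⟨y, hyb⟩) := by
          rintro b hzb rfl; exact hsy
        exact this _ _ _
      have h₂ : ∀ a (hza : agent z = a) (hxa : agent x = a) (hya : agent y = a),
          (R a).weak (some ⟨y, hya⟩) (some ⟨x, hxa⟩) := by
        rintro a hza hxa rfl
        refine hmy x hxa hax ?_
        have : ∀ b (hzb : agent z = b) (hxb : agent x = b),
            (R b).strict (some ⟨z, hzb⟩) (some ⟨x, hxb⟩) := by
          rintro b hzb rfl; exact hsx
        exact this _ _ _
      have := (R (agent z)).antisymm _ _ (h₁ _ rfl hx.symm hy.symm) (h₂ _ rfl hx.symm hy.symm)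
      simpa using this
    rintro x (hx | ⟨z, hz, hx⟩) y (hy | ⟨w, hw, hy⟩) hxy
    · exact ih x (accepted_subset C _ hx) y (accepted_subset C _ hy) hxy
    · have := ih x (accepted_subset C _ hx) w hw.1 (hxy.trans hy.1.symm)
      exact absurd (this ▸ hx) hw.2
    · have := ih y (accepted_subset C _ hy) z hz.1 (hxy.symm.trans hx.1.symm)
      exact absurd (this ▸ hy) hz.2
    · have : z = w := ih z hz.1 w hw.1 (hx.1.trans (hxy.trans hy.1.symm))
      subst this
      exact key x y z hx hy

theorem rejected_strict {agent : X → A} {inst : X → I}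
    (C : ∀ i, ChoiceRule (InstContract inst i)) (R : Profile agent) (s k : ℕ) :
    ∀ y ∈ rejected C R s, ∀ x ∈ considered C R (s + 1 + k), ∀ h : agent y = agent x,
      (R (agent x)).strict (some ⟨y, h⟩) (some ⟨x, rfl⟩) := by
  induction k with
  | zero =>
    rintro y hy x (hx | ⟨z, hz, hx⟩) h
    · have := considered_unique C R s y hy.1 x (accepted_subset C _ hx) h
      exact absurd (this ▸ hx) hy.2
    · have : z = y := considered_unique C R s z hz.1 y hy.1 (hx.1.trans h.symm)
      subst this
      exact hx.2.2.1
  | succ k ih =>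
    rintro y hy x (hx | ⟨z, hz, hx⟩) h
    · exact ih y hy x (accepted_subset C _ hx) h
    · have hyz : ∀ a (hya : agent y = a) (hza : agent z = a),
          (R a).strict (some ⟨y, hya⟩) (some ⟨z, hza⟩) := by
        rintro a hya rfl
        exact ih y hy z hz.1 hya
      exact (R (agent x)).strict_trans (hyz _ h hx.1) hx.2.2.1

/-- The deferred-acceptance algorithm stops. -/
theorem exists_rejected_eq_empty [Finite X] {agent : X → A} {inst : X → I}
    (C : ∀ i, ChoiceRule (InstContract inst i)) (R : Profile agent) :
    ∃ s, rejected C R s = ∅ := by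
  by_contra! hne
  choose f hf using hne
  have hlt : ∀ s t, s < t → f s ≠ f t := by
    intro s t hst heq
    obtain ⟨k, rfl⟩ := Nat.exists_eq_add_of_le (Nat.succ_le_of_lt hst)
    have hc : f s ∈ considered C R (s + 1 + k) := by
      rw [heq]; exact (hf (s + 1 + k)).1
    exact (rejected_strict C R s k (f s) (hf s) (f s) hc rfl).2 rfl
  refine not_injective_infinite_finite f fun s t hst => ?_
  rcases lt_trichotomy s t with h | h | h
  · exact absurd hst (hlt s t h)
  · exact h
  · exact absurd hst.symm (hlt t s h)

open Classical in
/-- The deferred-acceptance rule based on the choice rule profile `C`: the matching of the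
contracts accepted at the first step at which no contract is rejected. -/
noncomputable def deferredAcceptance [Finite X] {agent : X → A} {inst : X → I}
    (C : ∀ i, ChoiceRule (InstContract inst i)) : MatchingRule agent := fun R =>
  { contracts := accepted C (considered C R (Nat.find (exists_rejected_eq_empty C R)))
    card_le_one := (card_le_one_iff agent _).2 fun x hx y hy hxy =>
      considered_unique C R _ x (accepted_subset C _ hx) y (accepted_subset C _ hy) hxy }

end Model

end MatchingContracts

open MatchingContracts

namespace MatchingContracts

/-! ### Linear orders -/

section LinPref

variable {α : Type*}

/-! Call a matching stable if it satisfies (i)–(iv). A contract rejected by the greedy rule is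
spanned by the chosen contracts of higher priority, and it stays so spanned at later steps
(`rejected_mem_closure`). Every contract desired at the DA outcome was rejected at some step, so
this outcome is stable.

Conversely, (ii) and (iii) say that a contract desired at a stable `μ` lies in the closure of `μ_i`,
and even of `μ_i \ {x}` for each `x` in `μ_i` of lower priority. Hence the greedy rule never rejects
a contract of `μ` in favour of contracts in `μ` or desired at it (`IsStable.mem_accepted`), and by
induction on the steps DA is the best stable matching for all agents. Its contracts are then spanned
by those of `μ`, so it is no larger than `μ`, while it assigns every agent assigned at `μ`: all
stable matchings assign the same agents (`IsStable.agent_image_eq`).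

This invariance, applied to truncated preferences, gives both remaining claims. If a misreport won
`z`, then with only `z` acceptable the agent would be assigned at one stable matching and unassigned
at another. If `φ` is stable and strategy-proof, truncating at the DA contract keeps DA stable, so
`φ` must assign the truncating agent something at least as good; strategy-proofness and optimality
of DA then force equality. -/

theorem LinPref.weak_refl (r : LinPref α) (x : α) : r.weak x x := (r.total x x).elim id id

theorem LinPref.weak_of_not_strict (r : LinPref α) {x y : α} (h : ¬ r.strict x y) :
    r.weak y x := by
  by_cases hxy : x = y
  · exact hxy ▸ r.weak_refl x
  · exact (r.total x y).resolve_left fun h' => h ⟨h', hxy⟩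

theorem LinPref.not_weak_of_strict (r : LinPref α) {x y : α} (h : r.strict x y) :
    ¬ r.weak y x := fun h' => h.2 (r.antisymm _ _ h.1 h')

theorem LinPref.strict_of_strict_of_weak (r : LinPref α) {x y z : α}
    (h₁ : r.strict x y) (h₂ : r.weak y z) : r.strict x z := by
  refine ⟨r.trans _ _ _ h₁.1 h₂, ?_⟩
  rintro rfl
  exact r.not_weak_of_strict h₁ h₂

/-- A nonempty subset of a finite type has a best element. -/
theorem LinPref.exists_best [Finite α] (r : LinPref α) {S : Set α} (hS : S.Nonempty) :
    ∃ x ∈ S, ∀ y ∈ S, r.weak x y := by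
  have : IsTrans α r.strict := ⟨fun _ _ _ => r.strict_trans⟩
  have : Std.Irrefl r.strict := ⟨fun _ h => h.2 rfl⟩
  obtain ⟨m, hm, h⟩ := (Finite.wellFounded_of_trans_of_irrefl r.strict).has_min S hS
  exact ⟨m, hm, fun y hy => r.weak_of_not_strict (h y hy)⟩

end LinPref

/-! ### Greedy choice on a matroid -/

section Greedy

variable {α : Type*} {M : Matroid α} {p : LinPref α} {S : Set α}

/-- The first `s` elements of `S` in the order `p`. -/
def firstElements (p : LinPref α) (S : Set α) (s : ℕ) : Set α :=
  {x | x ∈ S ∧ {y | y ∈ S ∧ p.strict y x}.encard < s}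

theorem firstElements_eq (hS : S.Finite) {x : α} {s : ℕ}
    (hx : {y | y ∈ S ∧ p.strict y x}.encard = s) :
    firstElements p S s = {y | y ∈ S ∧ p.strict y x} := by
  ext y
  refine and_congr_right fun hy => ⟨fun h => ?_, fun h => ?_⟩
  · by_contra hyx
    have hxy := p.weak_of_not_strict hyx
    refine absurd h (not_lt.2 (hx ▸ Set.encard_le_encard fun z hz => ?_))
    exact ⟨hz.1, p.strict_of_strict_of_weak hz.2 hxy⟩
  · rw [← hx]
    refine (hS.subset fun _ h => h.1).encard_lt_encard ⟨fun z hz => ?_, fun hsub => ?_⟩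
    · exact ⟨hz.1, p.strict_trans hz.2 h⟩
    · exact (hsub ⟨hy, h⟩ : y ∈ S ∧ p.strict y y).2.2 rfl

theorem greedyStage_mono {s t : ℕ} (h : s ≤ t) :
    greedyStage M p S s ⊆ greedyStage M p S t :=
  monotone_nat_of_le_succ (f := greedyStage M p S) (fun _ => Set.subset_union_left) h

/-- Loop invariant: the current stage is a basis of the elements seen so far. Since it spans
everything above the next element, that element is skipped only if it lies in the closure of all
elements above it, which is the last clause. -/
theorem greedyStage_spec (hM : M.E = Set.univ) (hS : S.Finite) (s : ℕ) :
    greedyStage M p S s ⊆ firstElements p S s ∧ M.Indep (greedyStage M p S s) ∧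
      firstElements p S s ⊆ M.closure (greedyStage M p S s) ∧
      ∀ x ∈ firstElements p S s, x ∉ M.closure {y | y ∈ S ∧ p.strict y x} →
        x ∈ greedyStage M p S s := by
  induction s with
  | zero => simp [greedyStage, firstElements]
  | succ s ih =>
    obtain ⟨h₁, h₂, h₃, h₄⟩ := ih
    have hE : ∀ Y : Set α, Y ⊆ M.E := fun Y => hM ▸ Set.subset_univ Y
    have hmono : firstElements p S s ⊆ firstElements p S (s + 1) := fun x hx =>
      ⟨hx.1, hx.2.trans_le (by exact_mod_cast Nat.le_succ s)⟩
    -- The negative case is that `S` is already exhausted and the step changes nothing.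
    by_cases hex : ∃ x ∈ S, {y | y ∈ S ∧ p.strict y x}.encard = s
    · obtain ⟨x, hxS, hx⟩ := hex
      have hfirst := firstElements_eq hS hx
      have huniq : ∀ z ∈ S, {y | y ∈ S ∧ p.strict y z}.encard = s → z = x := by
        intro z hzS hz
        have hzx := hfirst.symm.trans (firstElements_eq hS hz)
        by_contra hne
        rcases p.total x z with h | h
        · have : x ∈ {y | y ∈ S ∧ p.strict y x} := by
            rw [hzx]; exact ⟨hxS, h, fun h => hne h.symm⟩
          exact this.2.2 rfl
        · have : z ∈ {y | y ∈ S ∧ p.strict y z} := by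
            rw [← hzx]; exact ⟨hzS, h, hne⟩
          exact this.2.2 rfl
      have hsucc : firstElements p S (s + 1) = insert x (firstElements p S s) := by
        refine Set.Subset.antisymm (fun z hz => ?_) (Set.insert_subset ⟨hxS, ?_⟩ hmono)
        · have hle : {y | y ∈ S ∧ p.strict y z}.encard ≤ s :=
            Order.le_of_lt_add_one (by simpa using hz.2)
          rcases hle.lt_or_eq with h | h
          · exact Or.inr ⟨hz.1, h⟩
          · exact Or.inl (huniq z hz.1 h)
        · rw [hx]; exact_mod_cast Nat.lt_succ_self s
      have hcl : M.closure (greedyStage M p S s) = M.closure {y | y ∈ S ∧ p.strict y x} := by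
        rw [← hfirst]
        exact (M.closure_subset_closure h₁).antisymm
          (M.closure_subset_closure_of_subset_closure h₃)
      by_cases hind : M.Indep (insert x (greedyStage M p S s))
      · have hstage : greedyStage M p S (s + 1) = insert x (greedyStage M p S s) := by
          refine Set.Subset.antisymm ?_ (Set.insert_subset (Or.inr ⟨hxS, hx, hind⟩)
            Set.subset_union_left)
          rintro z (hz | hz)
          · exact Or.inr hz
          · exact Or.inl (huniq z hz.1 hz.2.1)
        rw [hstage, hsucc]
        refine ⟨Set.insert_subset_insert h₁, hind, ?_, ?_⟩
        · refine Set.insert_subset (M.mem_closure_of_mem (Set.mem_insert _ _) (hE _)) ?_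
          exact h₃.trans (M.closure_subset_closure (Set.subset_insert _ _))
        · rintro z (rfl | hz) hzc
          · exact Set.mem_insert _ _
          · exact Or.inr (h₄ z hz hzc)
      · have hstage : greedyStage M p S (s + 1) = greedyStage M p S s := by
          refine Set.Subset.antisymm ?_ Set.subset_union_left
          rintro z (hz | hz)
          · exact hz
          · exact absurd (huniq z hz.1 hz.2.1 ▸ hz.2.2) hind
        have hxc : x ∈ M.closure (greedyStage M p S s) := by
          by_contra hxc
          exact hind ((h₂.notMem_closure_iff (hE {x} rfl)).1 hxc).1
        rw [hstage, hsucc]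
        refine ⟨h₁.trans (Set.subset_insert _ _), h₂, Set.insert_subset hxc h₃, ?_⟩
        rintro z (rfl | hz) hzc
        · exact absurd (hcl ▸ hxc) hzc
        · exact h₄ z hz hzc
    · have hsucc : firstElements p S (s + 1) = firstElements p S s := by
        refine Set.Subset.antisymm (fun z hz => ⟨hz.1, ?_⟩) hmono
        have hle : {y | y ∈ S ∧ p.strict y z}.encard ≤ s :=
          Order.le_of_lt_add_one (by simpa using hz.2)
        exact hle.lt_of_ne fun h => hex ⟨z, hz.1, h⟩
      have hstage : greedyStage M p S (s + 1) = greedyStage M p S s := by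
        refine Set.Subset.antisymm ?_ Set.subset_union_left
        rintro z (hz | hz)
        · exact hz
        · exact absurd ⟨z, hz.1, hz.2.1⟩ hex
      rw [hstage, hsucc]
      exact ⟨h₁, h₂, h₃, h₄⟩

theorem mem_firstElements_ncard (hS : S.Finite) {x : α} (hx : x ∈ S) :
    x ∈ firstElements p S S.ncard := by
  refine ⟨hx, ?_⟩
  rw [hS.cast_ncard_eq]
  refine (hS.subset fun _ h => h.1).encard_lt_encard ⟨fun z hz => hz.1, fun h => ?_⟩
  exact (h hx).2.2 rfl

theorem greedyRule_indep (hM : M.E = Set.univ) (hS : S.Finite) :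
    M.Indep ((greedyRule M p).choose S) :=
  (greedyStage_spec hM hS _).2.1

/-- The greedy rule chooses every element not spanned by the elements of higher priority. -/
theorem mem_greedyRule (hM : M.E = Set.univ) (hS : S.Finite) {x : α} (hx : x ∈ S)
    (hxc : x ∉ M.closure {y | y ∈ S ∧ p.strict y x}) : x ∈ (greedyRule M p).choose S :=
  (greedyStage_spec hM hS _).2.2.2 x (mem_firstElements_ncard hS hx) hxc

/-- A rejected element is spanned by the chosen elements of higher priority. -/
theorem mem_closure_greedyRule (hM : M.E = Set.univ) (hS : S.Finite) {x : α} (hx : x ∈ S)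
    (hxG : x ∉ (greedyRule M p).choose S) :
    x ∈ M.closure {y | y ∈ (greedyRule M p).choose S ∧ p.strict y x} := by
  have hxc : x ∈ M.closure {y | y ∈ S ∧ p.strict y x} := by
    by_contra h
    exact hxG (mem_greedyRule hM hS hx h)
  -- The stage reached just before `x` is considered spans all elements above `x`, and it is kept in
  -- the final choice.
  have hfin : {y | y ∈ S ∧ p.strict y x}.Finite := hS.subset fun _ h => h.1
  have hfirst := firstElements_eq (s := {y | y ∈ S ∧ p.strict y x}.ncard) hS
    hfin.cast_ncard_eq.symm
  obtain ⟨h₁, -, h₃, -⟩ := greedyStage_spec (p := p) hM hS {y | y ∈ S ∧ p.strict y x}.ncard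
  rw [hfirst] at h₁ h₃
  refine M.closure_subset_closure ?_ (M.closure_subset_closure_of_subset_closure h₃ hxc)
  exact fun y hy => ⟨greedyStage_mono (Set.ncard_le_ncard (fun _ h => h.1) hS) hy, (h₁ hy).2⟩

end Greedy
end MatchingContracts
namespace MatchingContracts

/-! ### Stable matchings and closure -/

section Stability

variable {A I X : Type*} {agent : X → A} {inst : X → I}

theorem Matching.assignment_eq_some_iff (μ : Matching agent) {a : A}
    (x : AgentContract agent a) : μ.assignment a = some x ↔ (x : X) ∈ μ.contracts := by
  have key : ∀ y ∈ agentPart agent μ.contracts a, ∀ z ∈ agentPart agent μ.contracts a, y = z :=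
    fun y hy z hz => Set.encard_le_one_iff.1 (μ.card_le_one a) y z hy hz
  unfold Matching.assignment
  split_ifs with h
  · refine ⟨fun hx => ?_, fun hx => congrArg some (key _ h.some_mem _ hx)⟩
    rw [← Option.some.inj hx]
    exact h.some_mem
  · exact ⟨fun hx => by simp at hx, fun hx => absurd ⟨x, hx⟩ h⟩

theorem Matching.ext_assignment {μ ν : Matching agent}
    (h : ∀ a, μ.assignment a = ν.assignment a) : μ = ν := by
  have hc : μ.contracts = ν.contracts := by
    ext x
    have h₁ := μ.assignment_eq_some_iff (a := agent x) ⟨x, rfl⟩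
    have h₂ := ν.assignment_eq_some_iff (a := agent x) ⟨x, rfl⟩
    rw [← h₁, ← h₂, h]
  cases μ
  cases ν
  cases hc
  rfl

theorem Matching.injOn_agent (μ : Matching agent) : Set.InjOn agent μ.contracts :=
  fun x hx y hy h => (card_le_one_iff agent μ.contracts).1 μ.card_le_one x hx y hy h

theorem Matching.mem_agent_image_iff (μ : Matching agent) {a : A} :
    a ∈ agent '' μ.contracts ↔ ∃ x : AgentContract agent a, μ.assignment a = some x := by
  constructor
  · rintro ⟨x, hx, rfl⟩
    exact ⟨⟨x, rfl⟩, (μ.assignment_eq_some_iff _).2 hx⟩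
  · rintro ⟨x, hx⟩
    exact ⟨x, (μ.assignment_eq_some_iff _).1 hx, x.2⟩

theorem prefersToAssignment_iff {R : Profile agent} {μ : Matching agent} {a : A}
    (x : AgentContract agent a) :
    PrefersToAssignment R μ x ↔ (R a).strict (some x) (μ.assignment a) := by
  obtain ⟨x, rfl⟩ := x
  exact Iff.rfl

theorem acceptable_iff {R : Profile agent} {a : A} (x : AgentContract agent a) :
    Acceptable R (x : X) ↔ (R a).weak (some x) none := by
  obtain ⟨x, rfl⟩ := x
  exact Iff.rfl

theorem isTop_iff {R : Profile agent} {a : A} (x : AgentContract agent a) :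
    IsTop R (x : X) ↔ (R a).weak (some x) none ∧
      ∀ z : AgentContract agent a, (R a).weak (some z) none → (R a).weak (some x) (some z) := by
  obtain ⟨x, rfl⟩ := x
  refine and_congr_right fun _ => ⟨fun h z hz => ?_, fun h z hz hz' => ?_⟩
  · exact h z z.2 ((acceptable_iff z).2 hz)
  · exact h ⟨z, hz⟩ ((acceptable_iff (⟨z, hz⟩ : AgentContract agent (agent x))).1 hz')

theorem isNext_iff {R : Profile agent} {a : A} (y x : AgentContract agent a) :
    IsNext R (y : X) x ↔ (R a).weak (some x) none ∧ (R a).strict (some y) (some x) ∧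
      ∀ z : AgentContract agent a, (R a).weak (some z) none → (R a).strict (some y) (some z) →
        (R a).weak (some x) (some z) := by
  obtain ⟨x, rfl⟩ := x
  constructor
  · rintro ⟨_, h₁, h₂, h₃⟩
    exact ⟨h₁, h₂, fun z hz hyz => h₃ z z.2 ((acceptable_iff z).2 hz) hyz⟩
  · rintro ⟨h₁, h₂, h₃⟩
    exact ⟨y.2, h₁, h₂, fun z hz hz' hyz =>
      h₃ ⟨z, hz⟩ ((acceptable_iff (⟨z, hz⟩ : AgentContract agent (agent x))).1 hz') hyz⟩

/-- A matching is stable if it is feasible, rank maximal, individually rational and has no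
justified envy under rank. -/
structure IsStable (inst : X → I) (M : ∀ i, Matroid (InstContract inst i))
    (prio : ∀ i, LinPref (InstContract inst i)) (R : Profile agent) (μ : Matching agent) :
    Prop where
  feasible : Feasible inst M μ
  rankMaximal : RankMaximal inst M R μ
  noEnvy : NoJustifiedEnvyUnderRank inst M prio R μ
  rational : IndividuallyRational R μ

variable {M : ∀ i, Matroid (InstContract inst i)} {prio : ∀ i, LinPref (InstContract inst i)}
  {R R' : Profile agent} {μ : Matching agent}

/-- Stability is inherited by a problem with fewer desired contracts. -/
theorem IsStable.transfer (h : IsStable inst M prio R μ)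
    (hpref : ∀ x, PrefersToAssignment R' μ x → PrefersToAssignment R μ x)
    (hir : IndividuallyRational R' μ) : IsStable inst M prio R' μ :=
  ⟨h.feasible, fun i x hx hx' => h.rankMaximal i x hx (hpref _ hx'),
    fun i x hx y hy hy' => h.noEnvy i x hx y hy (hpref _ hy'), hir⟩

theorem PrefersToAssignment.notMem {x : X} (h : PrefersToAssignment R μ x) :
    x ∉ μ.contracts := fun hx =>
  h.2 ((μ.assignment_eq_some_iff (a := agent x) ⟨x, rfl⟩).2 hx).symm

/-- Rank maximality in closure form: adding an element outside the closure would raise the finite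
rank by one. -/
theorem IsStable.mem_closure [Finite X] (hM : ∀ i, (M i).E = Set.univ)
    (h : IsStable inst M prio R μ) {i : I} {y : InstContract inst i}
    (hy : PrefersToAssignment R μ y) : y ∈ (M i).closure (instPart inst μ.contracts i) := by
  by_contra hc
  have h₁ := h.rankMaximal i y hy.notMem hy
  rw [Set.union_singleton,
    Matroid.eRk_insert_eq_add_one ⟨(hM i).symm ▸ Set.mem_univ _, hc⟩] at h₁
  have hfin : (M i).eRk (instPart inst μ.contracts i) ≠ ⊤ :=
    ((M i).eRk_le_encard _ |>.trans_lt (Set.toFinite _).encard_lt_top).ne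
  exact absurd h₁ ((ENat.lt_add_one_iff hfin).2 le_rfl).ne'

/-- No justified envy in closure form: outside this closure, adding `y` would restore the one unit
of rank lost by removing `x` from an independent set. -/
theorem IsStable.mem_closure_diff [Finite X] (hM : ∀ i, (M i).E = Set.univ)
    (h : IsStable inst M prio R μ) {i : I} {x y : InstContract inst i}
    (hx : (x : X) ∈ μ.contracts) (hy : PrefersToAssignment R μ y) (hyx : (prio i).strict y x) :
    y ∈ (M i).closure (instPart inst μ.contracts i \ {x}) := by
  by_contra hc
  have h₁ := h.noEnvy i x hx y hy.notMem hy hyx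
  have hind := h.feasible i
  have hx' : x ∈ instPart inst μ.contracts i := hx
  rw [Set.union_singleton,
    Matroid.eRk_insert_eq_add_one ⟨(hM i).symm ▸ Set.mem_univ _, hc⟩,
    hind.eRk_eq_encard, (hind.subset Set.sdiff_subset).eRk_eq_encard,
    Set.encard_sdiff_singleton_add_one hx'] at h₁
  exact lt_irrefl _ h₁

/-- A contract of a stable matching is chosen among contracts of the matching and contracts
desired at it. -/
theorem IsStable.mem_accepted [Finite X] (hM : ∀ i, (M i).E = Set.univ)
    (h : IsStable inst M prio R μ) {K : Set X}
    (hK : ∀ y ∈ K, y ∈ μ.contracts ∨ PrefersToAssignment R μ y) {x : X} (hx : x ∈ μ.contracts)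
    (hxK : x ∈ K) : x ∈ accepted (fun i => greedyRule (M i) (prio i)) K := by
  -- Every contract of `K` above `x` lies in the closure of `μ_i \ {x}`; if these spanned `x`, the
  -- set `μ_i` would be dependent.
  refine mem_greedyRule (hM _) (Set.toFinite _) hxK fun hc => ?_
  refine (h.feasible (inst x)).notMem_closure_sdiff_of_mem
    (show (⟨x, rfl⟩ : InstContract inst (inst x)) ∈ _ from hx) ?_
  refine (M (inst x)).closure_subset_closure_of_subset_closure ?_ hc
  rintro y ⟨hyK, hyx⟩
  rcases hK y hyK with hy | hy
  · exact (M _).mem_closure_of_mem ⟨hy, hyx.2⟩ (hM _ ▸ Set.subset_univ _)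
  · exact h.mem_closure_diff hM hx hy hyx

end Stability

/-! ### Truncated preferences -/

section Restrict

variable {α : Type*}

open Classical in
/-- The class of an alternative: contracts in `S`, then the null contract, then the others. -/
noncomputable def restrictClass (S : Set α) : Option α → ℕ
  | none => 1
  | some x => if x ∈ S then 0 else 2

/-- The preference obtained from `r` by declaring acceptable exactly the contracts in `S`. -/
noncomputable def LinPref.restrict (r : LinPref (Option α)) (S : Set α) :
    LinPref (Option α) where
  weak x y := restrictClass S x < restrictClass S y ∨
    restrictClass S x = restrictClass S y ∧ r.weak x y
  total x y := by
    rcases lt_trichotomy (restrictClass S x) (restrictClass S y) with h | h | h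
    · exact Or.inl (Or.inl h)
    · exact (r.total x y).imp (fun h' => Or.inr ⟨h, h'⟩) (fun h' => Or.inr ⟨h.symm, h'⟩)
    · exact Or.inr (Or.inl h)
  trans x y z := by
    rintro (h | ⟨h, h'⟩) (k | ⟨k, k'⟩)
    · exact Or.inl (h.trans k)
    · exact Or.inl (k ▸ h)
    · exact Or.inl (h ▸ k)
    · exact Or.inr ⟨h.trans k, r.trans _ _ _ h' k'⟩
  antisymm x y := by
    rintro (h | ⟨h, h'⟩) (k | ⟨k, k'⟩)
    · omega
    · omega
    · omega
    · exact r.antisymm _ _ h' k'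

variable {r : LinPref (Option α)} {S : Set α}

theorem LinPref.restrict_weak_none_iff {x : α} :
    (r.restrict S).weak (some x) none ↔ x ∈ S := by
  by_cases h : x ∈ S <;> simp [LinPref.restrict, restrictClass, h]

theorem LinPref.restrict_weak_some {x y : α} (hy : y ∈ S)
    (h : (r.restrict S).weak (some x) (some y)) : x ∈ S ∧ r.weak (some x) (some y) := by
  by_cases hx : x ∈ S <;> simp_all [LinPref.restrict, restrictClass]

theorem LinPref.restrict_weak_of_mem {x y : α} (hx : x ∈ S)
    (h : r.weak (some x) (some y)) : (r.restrict S).weak (some x) (some y) := by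
  by_cases hy : y ∈ S <;> simp_all [LinPref.restrict, restrictClass]

end Restrict
end MatchingContracts
namespace MatchingContracts

/-! ### The course of deferred acceptance -/

section DeferredAcceptance

variable {A I X : Type*} {agent : X → A} {inst : X → I}

theorem considered_acceptable (C : ∀ i, ChoiceRule (InstContract inst i)) (R : Profile agent)
    (s : ℕ) : ∀ x ∈ considered C R s, Acceptable R x := by
  induction s with
  | zero => exact fun x hx => hx.1
  | succ s ih =>
    rintro x (hx | ⟨y, -, h⟩)
    · exact ih x (accepted_subset C _ hx)
    · exact h.2.1

/-- At every step, an acceptable contract has been rejected before, or its agent has a contract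
under consideration which is at least as good. -/
theorem rejected_or_considered [Finite X] (C : ∀ i, ChoiceRule (InstContract inst i))
    (R : Profile agent) {a : A} (y : AgentContract agent a) (hy : (R a).weak (some y) none)
    (s : ℕ) : (∃ t < s, (y : X) ∈ rejected C R t) ∨
      ∃ x : AgentContract agent a, (x : X) ∈ considered C R s ∧ (R a).weak (some x) (some y) := by
  induction s with
  | zero =>
    obtain ⟨o, ⟨x, hx, rfl⟩, hbest⟩ := (R a).exists_best
      (S := some '' {z : AgentContract agent a | (R a).weak (some z) none}) ⟨_, y, hy, rfl⟩
    exact Or.inr ⟨x, (isTop_iff x).2 ⟨hx, fun z hz => hbest _ ⟨z, hz, rfl⟩⟩, hbest _ ⟨y, hy, rfl⟩⟩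
  | succ s ih =>
    rcases ih with ⟨t, ht, h⟩ | ⟨x, hx, hxy⟩
    · exact Or.inl ⟨t, ht.trans (Nat.lt_succ_self s), h⟩
    by_cases hacc : (x : X) ∈ accepted C (considered C R s)
    · exact Or.inr ⟨x, Or.inl hacc, hxy⟩
    -- A rejected `x` is either `y` itself or strictly better than `y`; in the latter case the next
    -- proposal is still at least as good as `y`.
    by_cases heq : x = y
    · exact Or.inl ⟨s, Nat.lt_succ_self s, heq ▸ ⟨hx, hacc⟩⟩
    have hxy' : (R a).strict (some x) (some y) := ⟨hxy, fun h => heq (Option.some.inj h)⟩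
    obtain ⟨o, ⟨w, hw, rfl⟩, hbest⟩ := (R a).exists_best
      (S := some '' {z : AgentContract agent a |
        (R a).weak (some z) none ∧ (R a).strict (some x) (some z)}) ⟨_, y, ⟨hy, hxy'⟩, rfl⟩
    refine Or.inr ⟨w, Or.inr ⟨x, ⟨hx, hacc⟩, (isNext_iff x w).2 ⟨hw.1, hw.2, ?_⟩⟩,
      hbest _ ⟨y, ⟨hy, hxy'⟩, rfl⟩⟩
    exact fun z hz hxz => hbest _ ⟨z, ⟨hz, hxz⟩, rfl⟩

theorem deferredAcceptance_spec [Finite X] (C : ∀ i, ChoiceRule (InstContract inst i))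
    (R : Profile agent) : ∃ n, (deferredAcceptance C R).contracts = considered C R n ∧
      accepted C (considered C R n) = considered C R n := by
  classical
  have h := Nat.find_spec (exists_rejected_eq_empty C R)
  have h' := (accepted_subset C _).antisymm (Set.sdiff_eq_empty.1 h)
  exact ⟨_, h', h'⟩

theorem deferredAcceptance_rational [Finite X] (C : ∀ i, ChoiceRule (InstContract inst i))
    (R : Profile agent) : IndividuallyRational R (deferredAcceptance C R) := by
  intro a
  obtain ⟨n, hn, -⟩ := deferredAcceptance_spec C R
  cases h : (deferredAcceptance C R).assignment a with
  | none => exact (R a).weak_refl _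
  | some x =>
    rw [Matching.assignment_eq_some_iff, hn] at h
    exact (acceptable_iff x).1 (considered_acceptable C R n x h)

/-- A contract desired at the outcome of deferred acceptance has been rejected. -/
theorem exists_mem_rejected [Finite X] (C : ∀ i, ChoiceRule (InstContract inst i))
    (R : Profile agent) {n : ℕ} (hn : (deferredAcceptance C R).contracts = considered C R n)
    {y : X} (hy : PrefersToAssignment R (deferredAcceptance C R) y) :
    ∃ t < n, y ∈ rejected C R t := by
  have hacc : (R (agent y)).weak (some ⟨y, rfl⟩) none :=
    (R (agent y)).trans _ _ _ hy.1 (deferredAcceptance_rational C R (agent y))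
  refine (rejected_or_considered C R ⟨y, rfl⟩ hacc n).resolve_right ?_
  rintro ⟨x, hx, hxy⟩
  rw [← hn, ← Matching.assignment_eq_some_iff] at hx
  exact (R (agent y)).not_weak_of_strict hy (hx ▸ hxy)

theorem mem_accepted_iff (C : ∀ i, ChoiceRule (InstContract inst i)) (Y : Set X) {i : I}
    (x : InstContract inst i) : (x : X) ∈ accepted C Y ↔ x ∈ (C i).choose (instPart inst Y i) := by
  obtain ⟨x, rfl⟩ := x
  exact Iff.rfl

/-! ### Stability of the outcome -/

variable {M : ∀ i, Matroid (InstContract inst i)} {prio : ∀ i, LinPref (InstContract inst i)}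

/-- A rejected contract remains spanned by the accepted contracts of higher priority. -/
theorem rejected_mem_closure [Finite X] (hM : ∀ i, (M i).E = Set.univ) (R : Profile agent)
    {i : I} {y : InstContract inst i} {t : ℕ}
    (hy : (y : X) ∈ rejected (fun i => greedyRule (M i) (prio i)) R t) (k : ℕ) :
    y ∈ (M i).closure {x | (x : X) ∈ accepted (fun i => greedyRule (M i) (prio i))
      (considered (fun i => greedyRule (M i) (prio i)) R (t + k)) ∧ (prio i).strict x y} := by
  have key : ∀ (s : ℕ) (i : I) (y : InstContract inst i),
      (y : X) ∈ rejected (fun i => greedyRule (M i) (prio i)) R s →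
      y ∈ (M i).closure {x | (x : X) ∈ accepted (fun i => greedyRule (M i) (prio i))
        (considered (fun i => greedyRule (M i) (prio i)) R s) ∧ (prio i).strict x y} := by
    intro s i y hy
    have hyS : y ∈ instPart inst (considered (fun i => greedyRule (M i) (prio i)) R s) i := hy.1
    have := mem_closure_greedyRule (hM i) (Set.toFinite _) hyS
      (fun h => hy.2 ((mem_accepted_iff (fun i => greedyRule (M i) (prio i)) _ y).2 h))
    simpa only [mem_accepted_iff] using this
  induction k with
  | zero => exact key t i y hy
  | succ k ih =>
    refine (M i).closure_subset_closure_of_subset_closure ?_ ih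
    rintro x ⟨hx, hxy⟩
    -- A spanning contract that is now rejected is replaced by the accepted contracts above it that
    -- span it; these are also above `y`.
    by_cases hx' : (x : X) ∈ accepted (fun i => greedyRule (M i) (prio i))
        (considered (fun i => greedyRule (M i) (prio i)) R (t + (k + 1)))
    · exact (M i).mem_closure_of_mem ⟨hx', hxy⟩ (hM i ▸ Set.subset_univ _)
    · have hr : (x : X) ∈ rejected (fun i => greedyRule (M i) (prio i)) R (t + (k + 1)) :=
        ⟨Or.inl hx, hx'⟩
      refine (M i).closure_subset_closure ?_ (key _ i x hr)
      exact fun z hz => ⟨hz.1, (prio i).strict_trans hz.2 hxy⟩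

/-- A desired `y` is spanned by the held contracts of higher priority. Adding `y` thus gains no
rank, even after removing a contract below `y`, which is not among the spanning ones. -/
theorem deferredAcceptance_isStable [Finite X] (hM : ∀ i, (M i).E = Set.univ)
    (R : Profile agent) :
    IsStable inst M prio R (deferredAcceptance (fun i => greedyRule (M i) (prio i)) R) := by
  obtain ⟨n, hn, hacc⟩ := deferredAcceptance_spec (fun i => greedyRule (M i) (prio i)) R
  set μ := deferredAcceptance (fun i => greedyRule (M i) (prio i)) R with hμ
  have hspan : ∀ i, ∀ y : InstContract inst i, PrefersToAssignment R μ y →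
      y ∈ (M i).closure {x | x ∈ instPart inst μ.contracts i ∧ (prio i).strict x y} := by
    intro i y hy
    obtain ⟨t, ht, h⟩ := exists_mem_rejected _ R hn hy
    have := rejected_mem_closure hM R h (n - t)
    rw [Nat.add_sub_cancel' ht.le, hacc, ← hn] at this
    exact this
  have hfeas : Feasible inst M μ := by
    intro i
    have : instPart inst μ.contracts i =
        (greedyRule (M i) (prio i)).choose (instPart inst μ.contracts i) := by
      ext x
      rw [← mem_accepted_iff (fun i => greedyRule (M i) (prio i)), hn, hacc]
      rfl
    rw [this]
    exact greedyRule_indep (hM i) (Set.toFinite _)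
  refine ⟨hfeas, fun i x _ hx => ?_, fun i x hx y hy hy' hyx => ?_,
    deferredAcceptance_rational _ R⟩
  · rw [Set.union_singleton, ← (M i).eRk_closure_eq, Matroid.closure_insert_eq_of_mem_closure,
      (M i).eRk_closure_eq]
    exact (M i).closure_subset_closure (fun _ h => h.1) (hspan i x hx)
  · have hc : y ∈ (M i).closure (instPart inst μ.contracts i \ {x}) := by
      refine (M i).closure_subset_closure ?_ (hspan i y hy')
      exact fun z hz => ⟨hz.1, fun h => (prio i).not_weak_of_strict hyx ((h : z = x) ▸ hz.2.1)⟩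
    rw [Set.union_singleton, ← (M i).eRk_closure_eq,
      Matroid.closure_insert_eq_of_mem_closure hc, (M i).eRk_closure_eq,
      (hfeas i).eRk_eq_encard, ((hfeas i).subset Set.sdiff_subset).eRk_eq_encard]
    have hss : instPart inst μ.contracts i \ {x} ⊂ instPart inst μ.contracts i :=
      ⟨Set.sdiff_subset, fun h => (h hx).2 rfl⟩
    exact (Set.toFinite _).encard_lt_encard hss

/-! ### Agent-optimality and invariance of the set of assigned agents -/

variable {R : Profile agent} {μ : Matching agent}

/-- In deferred acceptance, every contract under consideration is at least as good for its agent
as the contract of this agent in a stable matching. -/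
theorem IsStable.considered_weak [Finite X] (hM : ∀ i, (M i).E = Set.univ)
    (h : IsStable inst M prio R μ) (s : ℕ) (a : A) (x : AgentContract agent a)
    (hx : (x : X) ∈ considered (fun i => greedyRule (M i) (prio i)) R s) :
    (R a).weak (some x) (μ.assignment a) := by
  have hnone : ∀ (s : ℕ) (a : A) (x : AgentContract agent a),
      (x : X) ∈ considered (fun i => greedyRule (M i) (prio i)) R s →
      (∀ m, μ.assignment a = some m → (R a).weak (some x) (some m)) →
      (R a).weak (some x) (μ.assignment a) := by
    intro s a x hx hm
    cases ha : μ.assignment a with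
    | none => exact (acceptable_iff x).1 (considered_acceptable _ R s x hx)
    | some m => exact hm m ha
  have hacc : ∀ (a : A) (m : AgentContract agent a), μ.assignment a = some m →
      (R a).weak (some m) none := fun a m hm => hm ▸ h.rational a
  induction s generalizing a with
  | zero => exact hnone 0 a x hx fun m hm => ((isTop_iff x).1 hx).2 m (hacc a m hm)
  | succ s ih =>
    rcases hx with hx | ⟨z, hz, hzx⟩
    · exact ih a x (accepted_subset _ _ hx)
    · refine hnone (s + 1) a x (Or.inr ⟨z, hz, hzx⟩) fun m hm => ?_
      obtain ⟨z, rfl⟩ : ∃ z' : AgentContract agent a, (z' : X) = z :=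
        ⟨⟨z, hzx.1.trans x.2⟩, rfl⟩
      -- The rejected `z` is at least as good as `m` by induction. It cannot equal `m`: all
      -- contracts considered at that step are in `μ` or desired at it, so `m` would have been
      -- accepted.
      refine ((isNext_iff z x).1 hzx).2.2 m (hacc a m hm) ⟨hm ▸ ih a z hz.1, fun hzm => hz.2 ?_⟩
      refine h.mem_accepted hM (fun y hy => ?_)
        ((μ.assignment_eq_some_iff z).1 (hm.trans hzm.symm)) hz.1
      by_cases hyμ : y ∈ μ.contracts
      · exact Or.inl hyμ
      · refine Or.inr ⟨ih (agent y) ⟨y, rfl⟩ hy, fun heq => hyμ ?_⟩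
        exact (μ.assignment_eq_some_iff (a := agent y) ⟨y, rfl⟩).1 heq.symm

/-- Every agent weakly prefers the outcome of deferred acceptance to a stable matching. -/
theorem IsStable.deferredAcceptance_weak [Finite X] (hM : ∀ i, (M i).E = Set.univ)
    (h : IsStable inst M prio R μ) (a : A) :
    (R a).weak ((deferredAcceptance (fun i => greedyRule (M i) (prio i)) R).assignment a)
      (μ.assignment a) := by
  obtain ⟨n, hn, -⟩ := deferredAcceptance_spec (fun i => greedyRule (M i) (prio i)) R
  have hda := (deferredAcceptance_isStable (prio := prio) hM R).rational a
  cases hm : μ.assignment a with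
  | none => exact hda
  | some m =>
    refine (R a).weak_of_not_strict fun hs => ?_
    rw [← prefersToAssignment_iff] at hs
    obtain ⟨t, -, hmt⟩ := exists_mem_rejected _ R hn hs
    refine hmt.2 (h.mem_accepted hM (fun y hy => ?_) ((μ.assignment_eq_some_iff m).1 hm) hmt.1)
    by_cases hyμ : y ∈ μ.contracts
    · exact Or.inl hyμ
    · refine Or.inr ⟨h.considered_weak hM t (agent y) ⟨y, rfl⟩ hy, fun heq => hyμ ?_⟩
      exact (μ.assignment_eq_some_iff (a := agent y) ⟨y, rfl⟩).1 heq.symm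

/-- Each contract names exactly one institution, so cardinalities add up over institutions. Summing
over the image of `inst` keeps the sum finite for arbitrary `I`. -/
theorem ncard_le_of_instPart_le [Finite X] {Y Z : Set X}
    (h : ∀ i, (instPart inst Y i).encard ≤ (instPart inst Z i).encard) : Y.ncard ≤ Z.ncard := by
  classical
  have := Fintype.ofFinite X
  have key : ∀ (W : Set X) (i : I),
      ((W.toFinset.filter (fun x => inst x = i)).card : ℕ∞) = (instPart inst W i).encard := by
    intro W i
    rw [← Set.encard_coe_eq_coe_finsetCard,
      ← (Subtype.val_injective (p := fun x => inst x = i)).encard_image]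
    congr 1
    ext x
    simp [instPart, and_comm]
  rw [Set.ncard_eq_toFinset_card', Set.ncard_eq_toFinset_card',
    Finset.card_eq_sum_card_fiberwise (f := inst) (t := Finset.univ.image inst) (fun x _ => by simp),
    Finset.card_eq_sum_card_fiberwise (s := Z.toFinset) (f := inst)
      (t := Finset.univ.image inst) (fun x _ => by simp)]
  refine Finset.sum_le_sum fun i _ => ?_
  have := h i
  rw [← key, ← key] at this
  exact_mod_cast this

/-- The same agents are assigned at all stable matchings. -/
theorem IsStable.agent_image_eq [Finite X] (hM : ∀ i, (M i).E = Set.univ)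
    (h : IsStable inst M prio R μ) :
    agent '' μ.contracts =
      agent '' (deferredAcceptance (fun i => greedyRule (M i) (prio i)) R).contracts := by
  set ν := deferredAcceptance (fun i => greedyRule (M i) (prio i)) R
  have hν : IsStable inst M prio R ν := deferredAcceptance_isStable hM R
  -- By optimality a contract of `ν` outside `μ` is desired at `μ`, hence spanned by `μ_i`; for
  -- independent sets, rank is cardinality.
  have hle : ν.contracts.ncard ≤ μ.contracts.ncard := by
    refine ncard_le_of_instPart_le (inst := inst) fun i => ?_
    rw [← (hν.feasible i).eRk_eq_encard, ← (h.feasible i).eRk_eq_encard,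
      ← (M i).eRk_closure_eq (instPart inst μ.contracts i)]
    refine (M i).eRk_mono fun x hx => ?_
    by_cases hxμ : (x : X) ∈ μ.contracts
    · exact (M i).mem_closure_of_mem hxμ (hM i ▸ Set.subset_univ _)
    · refine h.mem_closure hM ⟨?_, fun heq => hxμ ?_⟩
      · have := h.deferredAcceptance_weak hM (agent x)
        rwa [(ν.assignment_eq_some_iff (a := agent x) ⟨x, rfl⟩).2 hx] at this
      · exact (μ.assignment_eq_some_iff (a := agent x) ⟨x, rfl⟩).1 heq.symm
  -- Optimality and individual rationality give one inclusion, and the count above turns it into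
  -- equality.
  refine Set.eq_of_subset_of_ncard_le (fun a ha => ?_) ?_ (Set.toFinite _)
  · obtain ⟨m, hm⟩ := μ.mem_agent_image_iff.1 ha
    rw [ν.mem_agent_image_iff]
    cases hν' : ν.assignment a with
    | some x => exact ⟨x, rfl⟩
    | none =>
      have h₁ := h.deferredAcceptance_weak hM a
      rw [show (deferredAcceptance (fun i => greedyRule (M i) (prio i)) R).assignment a = none
        from hν', hm] at h₁
      have h₂ := (R a).antisymm _ _ h₁ (hm ▸ h.rational a)
      simp at h₂
  · rwa [ν.injOn_agent.ncard_image, μ.injOn_agent.ncard_image]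

theorem IsStable.exists_assignment [Finite X] (hM : ∀ i, (M i).E = Set.univ)
    (h : IsStable inst M prio R μ) {ν : Matching agent} (hν : IsStable inst M prio R ν) {a : A}
    {x : AgentContract agent a} (hx : μ.assignment a = some x) :
    ∃ y, ν.assignment a = some y := by
  rw [← ν.mem_agent_image_iff, hν.agent_image_eq hM, ← h.agent_image_eq hM,
    μ.mem_agent_image_iff]
  exact ⟨x, hx⟩

end DeferredAcceptance
end MatchingContracts
namespace MatchingContracts

/-! ### Strategy-proofness and uniqueness -/

section Characterization

variable {A I X : Type*} {agent : X → A} {inst : X → I}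
  {M : ∀ i, Matroid (InstContract inst i)} {prio : ∀ i, LinPref (InstContract inst i)}

/-- Stability is inherited when the preference of one agent changes so that no new contract
becomes desired. -/
theorem IsStable.transfer_update {R R' : Profile agent} {μ : Matching agent} {a : A}
    (h : IsStable inst M prio R μ) (hR : ∀ b, b ≠ a → R' b = R b)
    (hpref : ∀ x : AgentContract agent a, (R' a).strict (some x) (μ.assignment a) →
      (R a).strict (some x) (μ.assignment a))
    (hir : (R' a).weak (μ.assignment a) none) : IsStable inst M prio R' μ := by
  refine h.transfer (fun x hx => ?_) (fun b => ?_)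
  · by_cases hxa : agent x = a
    · exact (prefersToAssignment_iff (⟨x, hxa⟩ : AgentContract agent a)).2
        (hpref _ ((prefersToAssignment_iff (⟨x, hxa⟩ : AgentContract agent a)).1 hx))
    · unfold PrefersToAssignment at hx
      rwa [hR _ hxa] at hx
  · by_cases hb : b = a
    · exact hb ▸ hir
    · rw [hR b hb]
      exact h.rational b

/-- Makes the preference hypothesis of `IsStable.transfer_update` vacuous at a matching that assigns
the only acceptable contract. -/
theorem LinPref.restrict_singleton_not_strict {α : Type*} {r : LinPref (Option α)} {x y : α} :
    ¬ (r.restrict {x}).strict (some y) (some x) := by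
  rintro ⟨h, hne⟩
  exact hne (congrArg some
    (Set.mem_singleton_iff.1 (LinPref.restrict_weak_some (Set.mem_singleton x) h).1))

/-- Deferred acceptance based on greedy choice rules is strategy-proof. -/
theorem deferredAcceptance_strategyProof [Finite X] (hM : ∀ i, (M i).E = Set.univ) :
    StrategyProof (deferredAcceptance (agent := agent)
      (fun i => greedyRule (M i) (prio i))) := by
  classical
  intro R a Ra'
  have hstable := fun R => deferredAcceptance_isStable (agent := agent) (prio := prio) hM R
  set φ := deferredAcceptance (agent := agent) (fun i => greedyRule (M i) (prio i))
  refine (R a).weak_of_not_strict fun hlt => ?_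
  cases hz : (φ (Function.update R a Ra')).assignment a with
  | none => exact (R a).not_weak_of_strict (hz ▸ hlt) ((hstable R).rational a)
  | some z =>
    have hlt' : (R a).strict (some z) ((φ R).assignment a) := by
      rw [← hz]
      convert hlt
    -- Here `z` is the gain from misreporting. In `R₁` only `z` is acceptable to `a`; in `R₂`
    -- exactly the contracts at least as good as `z` are.
    set S : Set (AgentContract agent a) := {y | (R a).weak (some y) (some z)} with hS
    set R₁ : Profile agent := Function.update R a ((R a).restrict {z}) with hR₁
    set R₂ : Profile agent := Function.update R a ((R a).restrict S) with hR₂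
    have e₁ : R₁ a = (R a).restrict {z} := Function.update_self ..
    have e₂ : R₂ a = (R a).restrict S := Function.update_self ..
    have h₁ : IsStable inst M prio R₁ (φ (Function.update R a Ra')) := by
      refine (hstable _).transfer_update (a := a) (fun b hb => by simp [hR₁, hb]) ?_ ?_
      · intro x hx
        rw [hz, e₁] at hx
        exact absurd hx LinPref.restrict_singleton_not_strict
      · rw [hz, e₁]
        exact LinPref.restrict_weak_none_iff.2 rfl
    have hzS : z ∈ S := (R a).weak_refl _
    -- Otherwise `a` gets some `y` in `S`. Everything preferred to `y` is also in `S`, so the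
    -- matching is stable at `R` and contradicts the optimality of `φ R`.
    have h₂ : (φ R₂).assignment a = none := by
      by_contra hne
      obtain ⟨y, hy⟩ := Option.ne_none_iff_exists'.1 hne
      have hyS : y ∈ S := by
        have := (hstable R₂).rational a
        rwa [hy, e₂, LinPref.restrict_weak_none_iff] at this
      have hyR : IsStable inst M prio R (φ R₂) := by
        refine (hstable R₂).transfer_update (a := a) (fun b hb => by simp [hR₂, hb]) ?_ ?_
        · intro x hx
          rw [hy] at hx ⊢
          rw [e₂]
          exact ⟨LinPref.restrict_weak_of_mem ((R a).trans _ _ _ hx.1 hyS) hx.1, hx.2⟩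
        · rw [hy]
          exact (R a).trans _ _ _ hyS ((R a).trans _ _ _ hlt'.1 ((hstable R).rational a))
      have := hyR.deferredAcceptance_weak hM a
      rw [hy] at this
      exact (R a).not_weak_of_strict hlt' ((R a).trans _ _ _ this hyS)
    -- At `R₁` an unassigned `a` desires only `z`, already desired at `R₂`. So `R₁` has stable
    -- matchings with and without `a`.
    have h₃ : IsStable inst M prio R₁ (φ R₂) := by
      refine (hstable R₂).transfer_update (a := a) (fun b hb => by simp [hR₁, hR₂, hb]) ?_ ?_
      · intro x hx
        rw [h₂] at hx ⊢
        rw [e₁] at hx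
        rw [e₂]
        refine ⟨LinPref.restrict_weak_none_iff.2 ?_, hx.2⟩
        rw [show x = z from
          Set.mem_singleton_iff.1 (LinPref.restrict_weak_none_iff.1 hx.1)]
        exact hzS
      · rw [h₂]
        exact LinPref.weak_refl _ _
    obtain ⟨y, hy⟩ := h₁.exists_assignment hM h₃ hz
    simp [h₂] at hy

/-- A stable and strategy-proof matching rule is deferred acceptance. -/
theorem eq_deferredAcceptance_of_strategyProof [Finite X] (hM : ∀ i, (M i).E = Set.univ)
    {φ : MatchingRule agent} (hφ : ∀ R, IsStable inst M prio R (φ R)) (hsp : StrategyProof φ) :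
    φ = deferredAcceptance (fun i => greedyRule (M i) (prio i)) := by
  classical
  funext R
  refine Matching.ext_assignment fun a => ?_
  have hstable := deferredAcceptance_isStable (agent := agent) (prio := prio) hM R
  have hweak := (hφ R).deferredAcceptance_weak hM a
  set μ := deferredAcceptance (fun i => greedyRule (M i) (prio i)) R
  cases hx : μ.assignment a with
  | none => exact (R a).antisymm _ _ (hx ▸ (hφ R).rational a) (hx ▸ hweak)
  | some x =>
    rw [hx] at hweak
    set S : Set (AgentContract agent a) := {y | (R a).weak (some y) (some x)}
    have e : (Function.update R a ((R a).restrict S)) a = (R a).restrict S :=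
      Function.update_self ..
    have hxS : x ∈ S := (R a).weak_refl _
    -- Truncating at `x` creates no new contract better than `x`.
    have hμ : IsStable inst M prio (Function.update R a ((R a).restrict S)) μ := by
      refine hstable.transfer_update (a := a) (fun b hb => by simp [hb]) ?_ ?_
      · intro y hy
        rw [hx] at hy ⊢
        rw [e] at hy
        exact ⟨(LinPref.restrict_weak_some hxS hy.1).2, hy.2⟩
      · rw [hx, e]
        exact LinPref.restrict_weak_none_iff.2 hxS
    have hφ' := hφ (Function.update R a ((R a).restrict S))
    -- Invariance forces `φ` to assign `a` after the truncation, and individual rationality makes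
    -- that contract at least as good as `x`.
    obtain ⟨y, hy⟩ := hμ.exists_assignment hM hφ' hx
    have hyS : y ∈ S := by
      have := hφ'.rational a
      rwa [hy, e, LinPref.restrict_weak_none_iff] at this
    have hsp' : (R a).weak ((φ R).assignment a) (some y) := by
      rw [← hy]
      convert hsp R a ((R a).restrict S)
    exact (R a).antisymm _ _ ((R a).trans _ _ _ hsp' hyS) hweak

end Characterization
end MatchingContracts

theorem mainTheorem6 {A I X : Type*} [Finite X] (agent : X → A) (inst : X → I)
    (M : ∀ i, Matroid (InstContract inst i)) (hM : ∀ i, (M i).E = Set.univ)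
    (prio : ∀ i, LinPref (InstContract inst i)) (φ : MatchingRule agent) :
    ((∀ R, Feasible inst M (φ R)) ∧
      (∀ R, RankMaximal inst M R (φ R)) ∧
      (∀ R, NoJustifiedEnvyUnderRank inst M prio R (φ R)) ∧
      (∀ R, IndividuallyRational R (φ R)) ∧
      StrategyProof φ) ↔
    φ = deferredAcceptance (fun i => greedyRule (M i) (prio i)) := by
  constructor
  · rintro ⟨h₁, h₂, h₃, h₄, h₅⟩
    exact eq_deferredAcceptance_of_strategyProof hM (fun R => ⟨h₁ R, h₂ R, h₃ R, h₄ R⟩) h₅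
  · rintro rfl
    have h := fun R => deferredAcceptance_isStable (agent := agent) (prio := prio) hM R
    exact ⟨fun R => (h R).feasible, fun R => (h R).rankMaximal, fun R => (h R).noEnvy,
      fun R => (h R).rational, deferredAcceptance_strategyProof hM⟩
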